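/- Let $H$ be a finite-dimensional complex Hilbert space (identified with $\mathbb{C}^d$ by an orthonormal basis). All further Hilbert spaces below are finite-dimensional too, and $\mathcal{B}(K)$ denotes the linear operators on $K$. A channel is a completely positive, trace-preserving linear map between such operator spaces; a state is a positive semi-definite operator of trace $1$. The trace norm is $\|A\|_1=\operatorname{tr}|A|$, and the norm of a linear functional $t:\mathcal{B}(H)\to\mathbb{C}$ is $\|t\|=\sup\{|t(A)| : \|A\|_1\le 1\}$; $t$ is positive if $t(A)\ge 0$ for every $A\ge 0$. For $N\ge 1$, an $N$-step discrimination strategy $D$ consists of Hilbert spaces $H_Z,H_i,H_o$, a state $s_0$ on $H_i$, and channels $\Lambda_0:\mathcal{B}(H_i)\to\mathcal{B}(H\otimes H_Z)$, $\Lambda_n:\mathcal{B}(H\otimes H_Z)\to\mathcal{B}(H\otimes H_Z)$ for $1\le n\le N-1$, and $\Lambda_N:\mathcal{B}(H\otimes H_Z)\to\mathcal{B}(H_o)$. For a channel $T$ on $\mathcal{B}(H)$ put $\rho_0^T=\Lambda_0(s_0)$ and $\rho_n^T=\Lambda_n\big((T\otimes\mathrm{id})(\rho_{n-1}^T)\big)$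 for $1\le n\le N$. For two sets $\mathcal{A},\mathcal{B}$ of channels on $\mathcal{B}(H)$ and a two-valued POVM $\Pi=\{\pi_A,\pi_B\}$ on $H_o$ (that is, $\pi_A,\pi_B\ge 0$ and $\pi_A+\pi_B=\mathbb{1}$), the discrimination error probability is $$P_e(D,\Pi)=\tfrac12\Big[\sup_{T\in\mathcal{A}}\operatorname{tr}(\pi_B\rho_N^T)+\sup_{T\in\mathcal{B}}\operatorname{tr}(\pi_A\rho_N^T)\Big],\qquad \sup\emptyset:=0.$$ If $T$ carries a transmission functional, i.e. a positive linear functional $\mathfrak{t}_T:\mathcal{B}(H)\to\mathbb{C}$, the total transmission is $\mathfrak{T}_T(D)=\sum_{n=0}^{N-1}\mathfrak{t}_T(\operatorname{tr}_Z\rho_n^T)$. If every $T\in\mathcal{A}\cup\mathcal{B}$ carries a transmission functional $\mathfrak{t}_T$, then $\mathcal{A}$ and $\mathcal{B}$ can be discriminated in a transmission-free manner if for all $\epsilon,\delta>0$ there are $N\ge 1$, an $N$-step discrimination strategy $D$ and a two-valued POVM $\Pi$ with $P_e(D,\Pi)<\epsilon$ and $\mathfrak{T}_T(D)<\delta$ for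 all $T\in\mathcal{A}\cup\mathcal{B}$. **Theorem.** Let $\mathcal{C}$ be a closed set of channels on $\mathcal{B}(H)$ with $\mathrm{id}\notin\mathcal{C}$, and let $v\in H$ be a unit vector such that for every $T\in\mathcal{C}$ the state $|v\rangle\langle v|$ is the only state that is a fixed point of $T$. Then there is a constant $C$ such that for every integer $N\ge 1$ there are an $N$-step discrimination strategy $D$ and a two-valued POVM $\Pi$ with $$P_e(D,\Pi)\le\frac{C}{N^2}$$ with respect to the sets $\{\mathrm{id}\}$ and $\mathcal{C}$, and such that moreover, for every $T\in\mathcal{C}$ and every transmission functional $\mathfrak{t}_T$ of $T$ with $\mathfrak{t}_T(|v\rangle\langle v|)=0$, $$\mathfrak{T}_T(D)\le\frac{C\,\|\mathfrak{t}_T\|}{N}.$$ In particular, if $\mathfrak{t}_{\mathrm{id}}=0$, every $T\in\mathcal{C}$ carries a transmission functional $\mathfrak{t}_T$ with $\mathfrak{t}_T(|v\rangle\langle v|)=0$, and $\sup_{T\in\mathcal{C}}\|\mathfrak{t}_T\|<\infty$, then $\{\mathrm{id}\}$ and $\mathcal{C}$ can be discriminated in a transmission-free manner. -/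

import Mathlib

open scoped Matrix ComplexOrder

universe u

noncomputable section

namespace QDisc

/-- Linear maps from the operators on `ℂ^m` to the operators on `ℂ^n`. All spaces are
finite-dimensional, so the topology of this type is the one of every norm on it. -/
abbrev SuperOp (m n : Type u) [Fintype m] [Fintype n] : Type u :=
  Matrix m m ℂ →L[ℂ] Matrix n n ℂ

/-- The rank-one operator `|v⟩⟨v|`. -/
def ketbra {m : Type u} [Fintype m] (v : EuclideanSpace ℂ m) : Matrix m m ℂ :=
  Matrix.of fun i j => v i * star (v j)

/-- Density operators. -/
def IsState {m : Type u} [Fintype m] (ρ : Matrix m m ℂ) : Prop :=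
  ρ.PosSemidef ∧ ρ.trace = 1

/-- `(T ⊗ id_k)(ρ)` for an operator `ρ` on `ℂ^m ⊗ ℂ^k = ℂ^(m × k)`: the map `T` is applied to
each of the blocks `(⟨·, a| ρ |·, b⟩)`. -/
def ampl {m n : Type u} [Fintype m] [Fintype n] {k : Type*} (T : SuperOp m n)
    (ρ : Matrix (m × k) (m × k) ℂ) : Matrix (n × k) (n × k) ℂ :=
  Matrix.of fun p q => T (Matrix.of fun i j => ρ (i, p.2) (j, q.2)) p.1 q.1

/-- The partial trace over the second tensor factor. -/
def ptrace {m k : Type*} [Fintype k] (ρ : Matrix (m × k) (m × k) ℂ) : Matrix m m ℂ :=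
  Matrix.of fun i j => ∑ a, ρ (i, a) (j, a)

/-- Quantum channels: completely positive, trace-preserving maps. -/
structure IsChannel {m n : Type u} [Fintype m] [Fintype n] (T : SuperOp m n) : Prop where
  completelyPositive : ∀ (k : ℕ) (ρ : Matrix (m × Fin k) (m × Fin k) ℂ),
    ρ.PosSemidef → (ampl T ρ).PosSemidef
  tracePreserving : ∀ A : Matrix m m ℂ, (T A).trace = A.trace

open scoped MatrixOrder Matrix.Norms.L2Operator in
/-- The trace norm `tr |A|`, with `|A| = √(Aᴴ A)`. -/
def traceNorm {m : Type u} [Fintype m] [DecidableEq m] (A : Matrix m m ℂ) : ℝ :=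
  (CFC.abs A).trace.re

/-- The norm of a linear functional on the operators, dual to the trace norm. -/
def dualNorm {m : Type u} [Fintype m] [DecidableEq m] (t : Matrix m m ℂ →L[ℂ] ℂ) : ℝ :=
  sSup {r : ℝ | ∃ A : Matrix m m ℂ, traceNorm A ≤ 1 ∧ r = ‖t A‖}

/-- Positive linear functionals, as used for transmission functionals. -/
def IsPositiveFunctional {m : Type u} [Fintype m] (t : Matrix m m ℂ →L[ℂ] ℂ) : Prop :=
  ∀ A : Matrix m m ℂ, A.PosSemidef → 0 ≤ t A

/-- An `N`-step discrimination strategy (`1 ≤ N`) for unknown channels on `H = ℂ^ι`. The ancilla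
space is `H_Z = ℂ^Z`, the input and output spaces are `H_i = ℂ^I` and `H_o = ℂ^O`. The channels are
`Λ_0 = first`, `Λ_n = mid n` for `1 ≤ n ≤ N - 1`, and `Λ_N = last`; the other values of `mid` are
irrelevant. -/
structure Strategy (ι : Type u) [Fintype ι] (N : ℕ) where
  one_le : 1 ≤ N
  Z : Type u
  I : Type u
  O : Type u
  [fintypeZ : Fintype Z]
  [fintypeI : Fintype I]
  [fintypeO : Fintype O]
  [decEqO : DecidableEq O]
  s₀ : Matrix I I ℂ
  first : SuperOp I (ι × Z)
  mid : ℕ → SuperOp (ι × Z) (ι × Z)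
  last : SuperOp (ι × Z) O
  isState : IsState s₀
  first_channel : IsChannel first
  mid_channel : ∀ n, 1 ≤ n → n < N → IsChannel (mid n)
  last_channel : IsChannel last

attribute [instance] Strategy.fintypeZ Strategy.fintypeI Strategy.fintypeO Strategy.decEqO

namespace Strategy

variable {ι : Type u} [Fintype ι] {N : ℕ}

/-- The intermediate states `ρ_n^T` for `0 ≤ n ≤ N - 1`: `ρ_0 = Λ_0 (s_0)` and
`ρ_n = Λ_n ((T ⊗ id_Z) (ρ_(n-1)))`. -/
def interState (D : Strategy ι N) (T : SuperOp ι ι) : ℕ → Matrix (ι × D.Z) (ι × D.Z) ℂ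
  | 0 => D.first D.s₀
  | n + 1 => D.mid (n + 1) (ampl T (D.interState T n))

/-- The output state `ρ_N^T = Λ_N ((T ⊗ id_Z) (ρ_(N-1)^T))`. -/
def finalState (D : Strategy ι N) (T : SuperOp ι ι) : Matrix D.O D.O ℂ :=
  D.last (ampl T (D.interState T (N - 1)))

/-- The total transmission `∑_{n=0}^{N-1} t (tr_Z ρ_n^T)` for the transmission functional `t`
of `T`; for a positive functional `t` and a channel `T` it is a sum of nonnegative reals. -/
def totalTransmission (D : Strategy ι N) (T : SuperOp ι ι) (t : Matrix ι ι ℂ →L[ℂ] ℂ) : ℝ :=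
  ∑ n ∈ Finset.range N, (t (ptrace (D.interState T n))).re

end Strategy

/-- A two-valued POVM `{π_A, π_B}` on `ℂ^O`. -/
structure POVM₂ (O : Type u) [Fintype O] [DecidableEq O] where
  A : Matrix O O ℂ
  B : Matrix O O ℂ
  posA : A.PosSemidef
  posB : B.PosSemidef
  add_eq_one : A + B = 1

/-- The discrimination error probability
`½ (sup_{T ∈ 𝒜} tr (π_B ρ_N^T) + sup_{T ∈ ℬ} tr (π_A ρ_N^T))`. For channels the suprema are over
subsets of `[0, 1]`; the supremum over the empty set is `0`. -/
def errorProb {ι : Type u} [Fintype ι] {N : ℕ} (𝒜 ℬ : Set (SuperOp ι ι)) (D : Strategy ι N)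
    (P : POVM₂ D.O) : ℝ :=
  (1 / 2) * (sSup ((fun T => (P.B * D.finalState T).trace.re) '' 𝒜) +
    sSup ((fun T => (P.A * D.finalState T).trace.re) '' ℬ))

/-- `𝒜` and `ℬ`, whose elements `T` carry the transmission functionals `t T`, can be discriminated
in a transmission-free manner. -/
def TransmissionFreeDiscriminable {ι : Type u} [Fintype ι] (𝒜 ℬ : Set (SuperOp ι ι))
    (t : SuperOp ι ι → Matrix ι ι ℂ →L[ℂ] ℂ) : Prop :=
  ∀ ε δ : ℝ, 0 < ε → 0 < δ → ∃ (N : ℕ) (D : Strategy ι N) (P : POVM₂ D.O),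
    errorProb 𝒜 ℬ D P < ε ∧ ∀ T ∈ 𝒜 ∪ ℬ, D.totalTransmission T (t T) < δ

end QDisc

end

/-! The proof is a quantum Zeno argument. Fix a unit vector `y` orthogonal to `x = v` and rotate by
the angle `θ = π / (2N)` from `x` towards `y` after each use of the unknown channel. If the channel
is the identity, the rotations add up and the final state is exactly `|y⟩⟨y|`. If it is some `T ∈
𝒞`, then `T` keeps pulling the state back to `P = |v⟩⟨v|`, and the mass outside `P` (`escape P`)
stays of order `θ²`. Measuring `|y⟩⟨y|` then errs with probability `O(1/N²)`. A positive functional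
vanishing at `P` is bounded by its norm times the escape mass, so `N` steps transmit `O(N θ²) =
O(1/N)`.

The uniform bound `O(θ²)` is `exists_escape_bound`. Uniqueness of the fixed state and compactness of
`𝒞` give one `k` for which `T^k` contracts the escape mass by a common factor
(`exists_uniform_escape_le`). Summing the escape masses of `X, T X, …, T^(k-1) X` gives a functional
that contracts at every single step (`lyapunov_map_le`). A rotation perturbs it quadratically in
`θ`, up to a factor close to `1` that the contraction absorbs (`PosOn.conj_add_le`). -/

noncomputable section

namespace QDisc

/-! ### Positive real functionals and their Cauchy–Schwarz type bounds -/

section PositiveFunctionals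

variable {m : Type u} [Fintype m]

/-- Positivity of a real-linear functional on matrices. -/
def PosOn (g : Matrix m m ℂ →ₗ[ℝ] ℝ) : Prop := ∀ X : Matrix m m ℂ, X.PosSemidef → 0 ≤ g X

/-- Positivity of `g` at `(√s A - B/√s) X (√s A - B/√s)ᴴ`, as in Young's inequality. -/
lemma PosOn.cross_le {g : Matrix m m ℂ →ₗ[ℝ] ℝ} (hg : PosOn g) {X : Matrix m m ℂ}
    (hX : X.PosSemidef) (A B : Matrix m m ℂ) {s : ℝ} (hs : 0 < s) :
    g (A * X * Bᴴ) + g (B * X * Aᴴ) ≤ s * g (A * X * Aᴴ) + s⁻¹ * g (B * X * Bᴴ) := by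
  obtain ⟨r, hr, rfl⟩ : ∃ r : ℝ, 0 < r ∧ s = r * r :=
    ⟨√s, Real.sqrt_pos.2 hs, (Real.mul_self_sqrt hs.le).symm⟩
  have h := hg _ (hX.mul_mul_conjTranspose_same (r • A - r⁻¹ • B))
  have e : (r • A - r⁻¹ • B) * X * (r • A - r⁻¹ • B)ᴴ =
      (r * r) • (A * X * Aᴴ) + (r * r)⁻¹ • (B * X * Bᴴ) - (A * X * Bᴴ) - (B * X * Aᴴ) := by
    have h1 : r * r⁻¹ = 1 := mul_inv_cancel₀ hr.ne'
    have h2 : r⁻¹ * r = 1 := inv_mul_cancel₀ hr.ne'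
    simp only [Matrix.conjTranspose_sub, Matrix.conjTranspose_smul, star_trivial, sub_mul, mul_sub,
      Matrix.smul_mul, Matrix.mul_smul, smul_smul, h1, h2, one_smul, mul_inv]
    abel
  rw [e] at h
  simp only [map_sub, map_add, map_smul, smul_eq_mul] at h
  linarith

/-- For `A = 1` and a small perturbation `B`, the cross terms are traded for a factor `1 + s`, and
`B` enters only quadratically. -/
lemma PosOn.conj_add_le {g : Matrix m m ℂ →ₗ[ℝ] ℝ} (hg : PosOn g) {X : Matrix m m ℂ}
    (hX : X.PosSemidef) (A B : Matrix m m ℂ) {s : ℝ} (hs : 0 < s) :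
    g ((A + B) * X * (A + B)ᴴ) ≤ (1 + s) * g (A * X * Aᴴ) + (1 + s⁻¹) * g (B * X * Bᴴ) := by
  have h := hg.cross_le hX A B hs
  have e : (A + B) * X * (A + B)ᴴ = A * X * Aᴴ + B * X * Bᴴ + (A * X * Bᴴ) + (B * X * Aᴴ) := by
    simp only [Matrix.conjTranspose_add, add_mul, mul_add]
    abel
  rw [e]
  simp only [map_add]
  linarith

/-- Since the `A` term vanishes, `s → ∞` is allowed in `PosOn.conj_add_le`. -/
lemma PosOn.le_compress {g : Matrix m m ℂ →ₗ[ℝ] ℝ} (hg : PosOn g) {X : Matrix m m ℂ}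
    (hX : X.PosSemidef) [DecidableEq m] {A B : Matrix m m ℂ} (hAB : A + B = 1)
    (h0 : g (A * X * Aᴴ) = 0) : g X ≤ g (B * X * Bᴴ) := by
  have key : ∀ s : ℝ, 0 < s → g X ≤ (1 + s⁻¹) * g (B * X * Bᴴ) := fun s hs => by
    have := hg.conj_add_le hX A B hs
    simpa [hAB, h0] using this
  have hb := hg _ (hX.mul_mul_conjTranspose_same B)
  refine le_of_forall_pos_le_add fun ε hε => ?_
  have h1 := key ((g (B * X * Bᴴ) + 1) / ε) (by positivity)
  have h2 : ((g (B * X * Bᴴ) + 1) / ε)⁻¹ * g (B * X * Bᴴ) ≤ ε := by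
    rw [inv_div, div_mul_eq_mul_div, div_le_iff₀ (by positivity)]
    nlinarith
  linarith

/-- The real part of the trace, as a functional. -/
def reTrace : Matrix m m ℂ →ₗ[ℝ] ℝ :=
  Complex.reLm ∘ₗ (Matrix.traceLinearMap m ℂ ℂ).restrictScalars ℝ

@[simp] lemma reTrace_apply (X : Matrix m m ℂ) : reTrace X = X.trace.re := rfl

lemma posOn_reTrace : PosOn (reTrace (m := m)) := fun _ hX =>
  (Complex.le_def.1 hX.trace_nonneg).1

lemma trace_eq_re {X : Matrix m m ℂ} (hX : X.PosSemidef) : X.trace = (X.trace.re : ℂ) := by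
  have := (Complex.le_def.1 hX.trace_nonneg).2
  apply Complex.ext <;> simp_all

/-- The functional `X ↦ Re tr (A X)`. -/
def pairing (A : Matrix m m ℂ) : Matrix m m ℂ →ₗ[ℝ] ℝ :=
  reTrace ∘ₗ (LinearMap.mulLeft ℝ A)

@[simp] lemma pairing_apply (A X : Matrix m m ℂ) : pairing A X = (A * X).trace.re := rfl

lemma trace_mul_of_idem {A : Matrix m m ℂ} (hA : A * A = A) (hA' : Aᴴ = A) (X : Matrix m m ℂ) :
    (A * X).trace = (A * X * Aᴴ).trace := by
  rw [Matrix.trace_mul_comm (A * X), hA', ← mul_assoc, hA]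

lemma posOn_pairing {A : Matrix m m ℂ} (hA : A * A = A) (hA' : Aᴴ = A) : PosOn (pairing A) :=
  fun X hX => by
    rw [pairing_apply, trace_mul_of_idem hA hA']
    exact posOn_reTrace _ (hX.mul_mul_conjTranspose_same A)

lemma pairing_le_pairing {A B : Matrix m m ℂ} (hA : (B - A) * (B - A) = B - A)
    (hA' : (B - A)ᴴ = B - A) {X : Matrix m m ℂ} (hX : X.PosSemidef) :
    pairing A X ≤ pairing B X := by
  have := posOn_pairing hA hA' X hX
  simp only [pairing_apply, sub_mul, Matrix.trace_sub, Complex.sub_re] at this ⊢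
  linarith

end PositiveFunctionals

/-! ### Channels, their powers, and conjugation by isometries -/

section Channels

variable {m n : Type u} [Fintype m] [Fintype n]

lemma IsChannel.map_posSemidef {T : SuperOp m n} (hT : IsChannel T) {X : Matrix m m ℂ}
    (hX : X.PosSemidef) : (T X).PosSemidef := by
  have h := (hT.completelyPositive 1 (X.submatrix Prod.fst Prod.fst)
    (hX.submatrix _)).submatrix (fun i => (i, (0 : Fin 1)))
  exact h

lemma IsChannel.map_isState {T : SuperOp m n} (hT : IsChannel T) {X : Matrix m m ℂ}
    (hX : IsState X) : IsState (T X) :=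
  ⟨hT.map_posSemidef hX.1, by rw [hT.tracePreserving, hX.2]⟩

lemma IsChannel.pow_posSemidef {T : SuperOp m m} (hT : IsChannel T) (k : ℕ) {X : Matrix m m ℂ}
    (hX : X.PosSemidef) : ((T ^ k) X).PosSemidef := by
  induction k with
  | zero => simpa using hX
  | succ k ih => rw [pow_succ']; exact hT.map_posSemidef ih

lemma IsChannel.pow_trace {T : SuperOp m m} (hT : IsChannel T) (k : ℕ) (X : Matrix m m ℂ) :
    ((T ^ k) X).trace = X.trace := by
  induction k with
  | zero => simp
  | succ k ih => rw [pow_succ']; exact (hT.tracePreserving _).trans ih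

lemma IsChannel.pow_isState {T : SuperOp m m} (hT : IsChannel T) (k : ℕ) {X : Matrix m m ℂ}
    (hX : IsState X) : IsState ((T ^ k) X) :=
  ⟨hT.pow_posSemidef k hX.1, by rw [hT.pow_trace, hX.2]⟩

/-- The superoperator `X ↦ V X Vᴴ`. -/
def conjOp (V : Matrix n m ℂ) : SuperOp m n :=
  LinearMap.toContinuousLinearMap
    { toFun := fun X => V * X * Vᴴ
      map_add' := fun X Y => by rw [Matrix.mul_add, Matrix.add_mul]
      map_smul' := fun c X => by simp }

@[simp] lemma conjOp_apply (V : Matrix n m ℂ) (X : Matrix m m ℂ) : conjOp V X = V * X * Vᴴ := rfl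

lemma isChannel_conjOp [DecidableEq m] {V : Matrix n m ℂ} (hV : Vᴴ * V = 1) :
    IsChannel (conjOp V) where
  completelyPositive k ρ hρ := by
    classical
    have h := hρ.mul_mul_conjTranspose_same (Matrix.kroneckerMap (· * ·) V (1 : Matrix (Fin k) (Fin k) ℂ))
    convert h using 1
    ext ⟨i, a⟩ ⟨j, b⟩
    simp [ampl, Matrix.mul_apply, Fintype.sum_prod_type, Matrix.one_apply, Finset.sum_mul,
      apply_ite]
  tracePreserving X := by
    rw [conjOp_apply, Matrix.trace_mul_comm, ← Matrix.mul_assoc, hV, Matrix.one_mul]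

end Channels

/-! ### Compactness of the set of states and of closed sets of channels -/

section States

variable {m : Type u} [Fintype m]

lemma norm_entry_le_trace {X : Matrix m m ℂ} (hX : X.PosSemidef) (i j : m) :
    ‖X i j‖ ≤ X.trace.re := by
  classical
  have hd : ∀ i, 0 ≤ (X i i).re := fun i => (Complex.le_def.1 (hX.diag_nonneg (i := i))).1
  have hd' : ∀ i, (X i i).im = 0 := fun i => (Complex.le_def.1 (hX.diag_nonneg (i := i))).2.symm
  have hle : ∀ i, (X i i).re ≤ X.trace.re := fun i => by
    rw [Matrix.trace, Complex.re_sum]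
    exact Finset.single_le_sum (f := fun i => (X i i).re) (fun i _ => hd i) (Finset.mem_univ i)
  -- The principal `2 × 2` minor gives `|X i j|² ≤ X i i * X j j`.
  have h := (hX.submatrix ![i, j]).det_nonneg
  rw [Matrix.det_fin_two] at h
  have hji : X j i = star (X i j) := (hX.1.apply j i).symm
  have h2 := (Complex.le_def.1 h).1
  simp [hji, hd', Complex.mul_re] at h2
  have h3 : ‖X i j‖ ^ 2 ≤ X.trace.re ^ 2 := by
    rw [← Complex.normSq_eq_norm_sq, Complex.normSq_apply]
    nlinarith [hd i, hd j, hle i, hle j]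
  exact abs_le_of_sq_le_sq' h3 ((hd i).trans (hle i)) |>.2

lemma isClosed_posSemidef : IsClosed {X : Matrix m m ℂ | X.PosSemidef} := by
  simp only [Matrix.posSemidef_iff_dotProduct_mulVec, Set.ofPred_and, Set.ofPred_forall, Matrix.IsHermitian]
  refine (isClosed_eq (by fun_prop) (by fun_prop)).inter (isClosed_iInter fun x => ?_)
  exact isClosed_le (by fun_prop) (by fun_prop)

lemma isCompact_states : IsCompact {X : Matrix m m ℂ | IsState X} := by
  have hc : IsClosed {X : Matrix m m ℂ | IsState X} :=
    isClosed_posSemidef.inter (isClosed_eq (by fun_prop) (by fun_prop))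
  have hK : IsCompact (Set.pi Set.univ fun _ : m => Set.pi Set.univ fun _ : m =>
      Metric.closedBall (0 : ℂ) 1) :=
    isCompact_univ_pi fun _ => isCompact_univ_pi fun _ => isCompact_closedBall 0 1
  refine hK.of_isClosed_subset hc fun X hX i _ j _ => ?_
  have := norm_entry_le_trace hX.1 i j
  simpa [hX.2] using this

open scoped MatrixOrder Matrix.Norms.L2Operator in
lemma span_posSemidef [DecidableEq m] :
    Submodule.span ℂ {X : Matrix m m ℂ | X.PosSemidef} = ⊤ := by
  have := CStarAlgebra.span_nonneg (A := Matrix m m ℂ)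
  simpa only [Matrix.nonneg_iff_posSemidef] using this

lemma eq_zero_of_trace_eq_zero {X : Matrix m m ℂ} (hX : X.PosSemidef) (h : X.trace.re = 0) :
    X = 0 := by
  ext i j
  have := norm_entry_le_trace hX i j
  rw [h] at this
  simpa using this

lemma isState_normalize {X : Matrix m m ℂ} (hX : X.PosSemidef) (h : 0 < X.trace.re) :
    IsState (X.trace.re⁻¹ • X) := by
  refine ⟨hX.smul (by positivity), ?_⟩
  rw [Matrix.trace_smul, trace_eq_re hX]
  simp [h.ne']

lemma superOp_eq_zero {T : SuperOp m m} (h : ∀ X, IsState X → T X = 0) : T = 0 := by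
  classical
  have h1 : ∀ X : Matrix m m ℂ, X.PosSemidef → T X = 0 := fun X hX => by
    rcases (posOn_reTrace X hX).eq_or_lt with h0 | h0
    · rw [eq_zero_of_trace_eq_zero hX h0.symm, map_zero]
    · have := h _ (isState_normalize hX h0)
      rw [T.map_smul_of_tower] at this
      exact (smul_eq_zero.1 this).resolve_left (inv_ne_zero h0.ne')
  have h2 : (T : Matrix m m ℂ →ₗ[ℂ] Matrix m m ℂ) = 0 :=
    LinearMap.ext_on span_posSemidef fun X hX => h1 X hX
  ext1 X
  exact LinearMap.congr_fun h2 X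

/-- Evaluation at all states is an injective linear map on a finite-dimensional space, hence a
closed embedding, and it sends channels into a product of compact sets of states. -/
lemma isCompact_of_isClosed_channels {𝒞 : Set (SuperOp m m)} (hc : IsClosed 𝒞)
    (h : ∀ T ∈ 𝒞, IsChannel T) : IsCompact 𝒞 := by
  let Φ : SuperOp m m →ₗ[ℂ] ({X : Matrix m m ℂ // IsState X} → Matrix m m ℂ) :=
    { toFun := fun T X => T X.1
      map_add' := fun _ _ => rfl
      map_smul' := fun _ _ => rfl }
  have hΦ : Topology.IsClosedEmbedding Φ := by
    refine LinearMap.isClosedEmbedding_of_injective (LinearMap.ker_eq_bot'.2 fun T hT => ?_)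
    exact superOp_eq_zero fun X hX => congrFun hT ⟨X, hX⟩
  refine (hΦ.isCompact_preimage (isCompact_univ_pi fun _ => isCompact_states)).of_isClosed_subset
    hc fun T hT X _ => (h T hT).map_isState X.2

lemma continuous_superOp_apply :
    Continuous fun q : SuperOp m m × Matrix m m ℂ => q.1 q.2 := by
  classical
  have : (fun q : SuperOp m m × Matrix m m ℂ => q.1 q.2) =
      fun q => ∑ i, ∑ j, q.2 i j • q.1 (Matrix.single i j 1) := by
    funext q
    conv_lhs => rw [Matrix.matrix_eq_sum_single q.2]
    simp only [map_sum]
    refine Finset.sum_congr rfl fun i _ => Finset.sum_congr rfl fun j _ => ?_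
    rw [← map_smul, Matrix.smul_single, smul_eq_mul, mul_one]
  rw [this]
  refine continuous_finsetSum _ fun i _ => continuous_finsetSum _ fun j _ => ?_
  exact ((continuous_snd.matrix_elem i j)).smul
    ((continuous_eval_const (Matrix.single i j (1 : ℂ))).comp continuous_fst)

lemma continuous_superOp_pow_apply (k : ℕ) :
    Continuous fun q : SuperOp m m × Matrix m m ℂ => (q.1 ^ k) q.2 := by
  induction k with
  | zero => simpa using continuous_snd
  | succ k ih =>
    simp only [pow_succ']
    exact continuous_superOp_apply.comp (continuous_fst.prodMk ih)

end States

end QDisc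
end

/-! ### Existence of fixed states -/

noncomputable section

namespace QDisc

open Filter Topology

variable {m : Type u} [Fintype m]

/-- Krylov–Bogoliubov: every limit point of the Cesàro means of the orbit of `ρ` is fixed by `T`. -/
lemma exists_fixed_state {T : SuperOp m m} {S : Set (Matrix m m ℂ)}
    (hS : IsClosed S) (hSc : Convex ℝ S) (hSs : ∀ X ∈ S, IsState X) {ρ : Matrix m m ℂ}
    (hρ : ∀ k, (T ^ k) ρ ∈ S) : ∃ σ ∈ S, T σ = σ := by
  have hcomp : IsCompact S := isCompact_states.of_isClosed_subset hS hSs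
  let a : ℕ → Matrix m m ℂ := fun n =>
    ((n : ℝ) + 1)⁻¹ • ∑ k ∈ Finset.range (n + 1), (T ^ k) ρ
  have ha : ∀ n, a n ∈ S := fun n => by
    simp only [a, Finset.smul_sum]
    refine hSc.sum_mem (fun _ _ => by positivity) ?_ fun k _ => hρ k
    simp
    field_simp
  have : FirstCountableTopology (Matrix m m ℂ) :=
    inferInstanceAs (FirstCountableTopology (m → m → ℂ))
  obtain ⟨σ, hσ, φ, hφ, hlim⟩ := hcomp.tendsto_subseq ha
  refine ⟨σ, hσ, ?_⟩
  -- The sum telescopes, and the entries of a difference of two states are at most `2` in absolute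
  -- value.
  have hdiff : ∀ n, T (a n) - a n = ((n : ℝ) + 1)⁻¹ • ((T ^ (n + 1)) ρ - ρ) := fun n => by
    have h1 : T (a n) = ((n : ℝ) + 1)⁻¹ • ∑ k ∈ Finset.range (n + 1), (T ^ (k + 1)) ρ := by
      simp only [a]
      rw [T.map_smul_of_tower, map_sum]
      simp only [pow_succ', mul_apply_eq_comp]
    rw [h1, ← smul_sub, ← Finset.sum_sub_distrib,
      Finset.sum_range_sub (fun k => (T ^ k) ρ)]
    simp
  have hz : Tendsto (fun n => T (a n) - a n) atTop (𝓝 0) := by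
    refine tendsto_pi_nhds.2 fun i => tendsto_pi_nhds.2 fun j => ?_
    change Tendsto (fun n => (T (a n) - a n : Matrix m m ℂ) i j) atTop (𝓝 (0 : ℂ))
    rw [tendsto_zero_iff_norm_tendsto_zero]
    have hb : Tendsto (fun n : ℕ => ((n : ℝ) + 1)⁻¹ * 2) atTop (𝓝 0) := by
      have := (tendsto_one_div_add_atTop_nhds_zero_nat (𝕜 := ℝ)).mul_const 2
      simpa using this
    refine squeeze_zero (fun _ => norm_nonneg _) (fun n => ?_) hb
    rw [hdiff, Matrix.smul_apply, Matrix.sub_apply, norm_smul, Real.norm_of_nonneg (by positivity)]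
    gcongr
    have h1 := hSs _ (hρ (n + 1))
    have h2 := hSs _ (hρ 0)
    have e1 := norm_entry_le_trace h1.1 i j
    have e2 := norm_entry_le_trace h2.1 i j
    rw [h1.2] at e1
    rw [h2.2] at e2
    simp only [pow_zero, one_apply_eq_self, Complex.one_re] at e1 e2
    exact (norm_sub_le _ _).trans (by linarith)
  have h2 : Tendsto (fun n => T (a (φ n)) - a (φ n)) atTop (𝓝 (T σ - σ)) :=
    ((T.continuous.tendsto σ).comp hlim).sub hlim
  have h3 := tendsto_nhds_unique h2 (hz.comp hφ.tendsto_atTop)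
  exact sub_eq_zero.1 h3

/-! ### The mass outside a pure state and its uniform contraction -/

variable [DecidableEq m]

/-- `P` is an orthogonal projection of rank one. -/
structure IsPure (P : Matrix m m ℂ) : Prop where
  herm : Pᴴ = P
  idem : P * P = P
  trace : P.trace = 1
  compress : ∀ X : Matrix m m ℂ, P * X * P = (P * X).trace • P

lemma IsPure.compl_idem {P : Matrix m m ℂ} (hP : IsPure P) : (1 - P) * (1 - P) = 1 - P := by
  simp [sub_mul, mul_sub, hP.idem]

lemma IsPure.compl_herm {P : Matrix m m ℂ} (hP : IsPure P) : (1 - P)ᴴ = 1 - P := by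
  simp [hP.herm]

omit [DecidableEq m] in
lemma IsPure.isState {P : Matrix m m ℂ} (hP : IsPure P) : IsState P := by
  refine ⟨?_, hP.trace⟩
  have := Matrix.posSemidef_self_mul_conjTranspose P
  rwa [hP.herm, hP.idem] at this

/-- The mass outside of the pure state `P`. -/
abbrev escape (P : Matrix m m ℂ) : Matrix m m ℂ →ₗ[ℝ] ℝ := pairing (1 - P)

lemma escape_self {P : Matrix m m ℂ} (hP : IsPure P) : escape P P = 0 := by
  simp [sub_mul, hP.idem]

lemma escape_nonneg {P : Matrix m m ℂ} (hP : IsPure P) {X : Matrix m m ℂ} (hX : X.PosSemidef) :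
    0 ≤ escape P X := posOn_pairing hP.compl_idem hP.compl_herm X hX

lemma escape_le_reTrace {P : Matrix m m ℂ} (hP : IsPure P) {X : Matrix m m ℂ}
    (hX : X.PosSemidef) : escape P X ≤ X.trace.re := by
  have := pairing_le_pairing (A := 1 - P) (B := 1) (by simp [hP.idem]) (by simp [hP.herm]) hX
  simpa using this

lemma escape_eq {P : Matrix m m ℂ} (hP : IsPure P) (X : Matrix m m ℂ) :
    escape P X = ((1 - P) * X * (1 - P)ᴴ).trace.re := by
  rw [pairing_apply, trace_mul_of_idem hP.compl_idem hP.compl_herm]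

/-- A positive functional vanishing on `P` only depends on the compression to the complement. -/
lemma PosOn.le_compress_pure {P : Matrix m m ℂ} (hP : IsPure P) {g : Matrix m m ℂ →ₗ[ℝ] ℝ}
    (hg : PosOn g) (h0 : g P = 0) {X : Matrix m m ℂ} (hX : X.PosSemidef) :
    g X ≤ g ((1 - P) * X * (1 - P)ᴴ) := by
  refine hg.le_compress hX (add_sub_cancel P 1) ?_
  have h1 : (P * X * Pᴴ) = (P * X).trace.re • P := by
    have h2 : (P * X).trace = ((P * X).trace.re : ℂ) := by
      rw [trace_mul_of_idem hP.idem hP.herm]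
      exact trace_eq_re (hX.mul_mul_conjTranspose_same P)
    rw [hP.herm, hP.compress, h2]
    ext i j
    simp
  rw [h1, map_smul, h0, smul_zero]

/-- The trace of the compression of `X` to the complement of `P` is the escape mass, so vanishing at
`P` upgrades a bound by the trace to a bound by the escape mass. -/
lemma PosOn.le_mul_escape {P : Matrix m m ℂ} (hP : IsPure P) {g : Matrix m m ℂ →ₗ[ℝ] ℝ}
    (hg : PosOn g) (h0 : g P = 0) {c : ℝ} (hc : ∀ X : Matrix m m ℂ, X.PosSemidef → g X ≤ c * X.trace.re)
    {X : Matrix m m ℂ} (hX : X.PosSemidef) : g X ≤ c * escape P X := by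
  rw [escape_eq hP]
  exact (hg.le_compress_pure hP h0 hX).trans (hc _ (hX.mul_mul_conjTranspose_same _))

/-- The functional `X ↦ escape P (T^k X)`. -/
def escapeAfter (P : Matrix m m ℂ) (T : SuperOp m m) (k : ℕ) : Matrix m m ℂ →ₗ[ℝ] ℝ :=
  escape P ∘ₗ ((T ^ k).toLinearMap).restrictScalars ℝ

@[simp] lemma escapeAfter_apply (P : Matrix m m ℂ) (T : SuperOp m m) (k : ℕ) (X : Matrix m m ℂ) :
    escapeAfter P T k X = escape P ((T ^ k) X) := rfl

lemma posOn_escapeAfter {P : Matrix m m ℂ} (hP : IsPure P) {T : SuperOp m m} (hT : IsChannel T)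
    (k : ℕ) : PosOn (escapeAfter P T k) := fun _ hX => escape_nonneg hP (hT.pow_posSemidef k hX)

omit [DecidableEq m] in
lemma pow_apply_fixed {T : SuperOp m m} {P : Matrix m m ℂ} (h : T P = P) (k : ℕ) :
    (T ^ k) P = P := by
  induction k with
  | zero => simp
  | succ k ih => rw [pow_succ', mul_apply_eq_comp, ih, h]

lemma escape_map_le {P : Matrix m m ℂ} (hP : IsPure P) {T : SuperOp m m} (hT : IsChannel T)
    (h : T P = P) {X : Matrix m m ℂ} (hX : X.PosSemidef) : escape P (T X) ≤ escape P X := by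
  have := (posOn_escapeAfter hP hT 1).le_mul_escape hP (c := 1)
    (by rw [escapeAfter_apply, pow_apply_fixed h, escape_self hP]) (fun Y hY => by
      rw [escapeAfter_apply, one_mul, ← hT.pow_trace 1 Y]
      exact escape_le_reTrace hP (hT.pow_posSemidef 1 hY)) hX
  rwa [escapeAfter_apply, pow_one, one_mul] at this

lemma escape_pow_antitone {P : Matrix m m ℂ} (hP : IsPure P) {T : SuperOp m m} (hT : IsChannel T)
    (h : T P = P) {X : Matrix m m ℂ} (hX : X.PosSemidef) :
    Antitone fun k => escape P ((T ^ k) X) :=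
  antitone_nat_of_succ_le fun k => by
    rw [pow_succ']
    exact escape_map_le hP hT h (hT.pow_posSemidef k hX)

/-- Otherwise the orbit stays in the closed convex set of states with escape mass at least `1`. This
set would contain a fixed state, which differs from `P`. -/
lemma exists_escape_lt_one {P : Matrix m m ℂ} (hP : IsPure P) {T : SuperOp m m}
    (hT : IsChannel T) (hfix : ∀ ρ, IsState ρ → (T ρ = ρ ↔ ρ = P)) {ρ : Matrix m m ℂ}
    (hρ : IsState ρ) : ∃ k, escape P ((T ^ k) ρ) < 1 := by
  by_contra! hcon
  have hle : ∀ X, IsState X → escape P X ≤ 1 := fun X hX => by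
    have := escape_le_reTrace hP hX.1
    simpa [hX.2] using this
  have hcont : Continuous (escape P) := (escape P).continuous_of_finiteDimensional
  obtain ⟨σ, hσ, hTσ⟩ := exists_fixed_state (T := T) (S := {X | IsState X} ∩ {X | 1 ≤ escape P X})
    (isCompact_states.isClosed.inter (isClosed_le continuous_const hcont))
    (by
      intro X hX Y hY a b ha hb hab
      refine ⟨⟨(hX.1.1.smul ha).add (hY.1.1.smul hb), ?_⟩, ?_⟩
      · rw [Matrix.trace_add, Matrix.trace_smul, Matrix.trace_smul, hX.1.2, hY.1.2, ← add_smul,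
          hab, one_smul]
      · have h1 : 1 ≤ escape P X := hX.2
        have h2 : 1 ≤ escape P Y := hY.2
        change 1 ≤ escape P (a • X + b • Y)
        rw [map_add, map_smul, map_smul, smul_eq_mul, smul_eq_mul]
        nlinarith)
    (fun X hX => hX.1) (ρ := ρ) (fun k => ⟨hT.pow_isState k hρ, hcon k⟩)
  have h1 : 1 ≤ escape P σ := hσ.2
  rw [(hfix σ hσ.1).1 hTσ, escape_self hP] at h1
  norm_num at h1

lemma exists_uniform_escape_le {P : Matrix m m ℂ} (hP : IsPure P) {𝒞 : Set (SuperOp m m)}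
    (hclosed : IsClosed 𝒞) (hch : ∀ T ∈ 𝒞, IsChannel T)
    (hfix : ∀ T ∈ 𝒞, ∀ ρ, IsState ρ → (T ρ = ρ ↔ ρ = P)) :
    ∃ (k : ℕ) (c : ℝ), 0 < c ∧ c ≤ 1 ∧
      ∀ T ∈ 𝒞, ∀ X : Matrix m m ℂ, X.PosSemidef → escape P ((T ^ k) X) ≤ (1 - c) * escape P X := by
  have hK : IsCompact (𝒞 ×ˢ {X : Matrix m m ℂ | IsState X}) :=
    (isCompact_of_isClosed_channels hclosed hch).prod isCompact_states
  let F : ℕ → SuperOp m m × Matrix m m ℂ → ℝ := fun k q => escape P ((q.1 ^ k) q.2)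
  have hF : ∀ k, Continuous (F k) := fun k =>
    (escape P).continuous_of_finiteDimensional.comp (continuous_superOp_pow_apply k)
  have hTP : ∀ T ∈ 𝒞, T P = P := fun T hT => (hfix T hT P hP.isState).2 rfl
  have hanti : ∀ q ∈ 𝒞 ×ˢ {X : Matrix m m ℂ | IsState X}, Antitone fun k => F k q := fun q hq =>
    escape_pow_antitone hP (hch _ hq.1) (hTP _ hq.1) hq.2.1
  -- These open sets increase with `k` on the compact set, so a finite subcover yields a single `k`;
  -- the maximum of `F k` then yields `c`.
  obtain ⟨s, hs⟩ := hK.elim_finite_subcover (fun k => {q | F k q < 1})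
    (fun k => isOpen_lt (hF k) continuous_const) fun q hq => by
      obtain ⟨k, hk⟩ := exists_escape_lt_one hP (hch _ hq.1) (hfix _ hq.1) hq.2
      exact Set.mem_iUnion.2 ⟨k, hk⟩
  obtain ⟨k, hk⟩ : ∃ k, ∀ q ∈ 𝒞 ×ˢ {X : Matrix m m ℂ | IsState X}, F k q < 1 := by
    refine ⟨s.sup id, fun q hq => ?_⟩
    obtain ⟨j, hj, hlt⟩ : ∃ j ∈ s, F j q < 1 := by simpa using hs hq
    exact (hanti q hq (Finset.le_sup (f := id) hj)).trans_lt hlt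
  obtain ⟨c, hc0, hc1, hc⟩ : ∃ c : ℝ, 0 < c ∧ c ≤ 1 ∧
      ∀ q ∈ 𝒞 ×ˢ {X : Matrix m m ℂ | IsState X}, F k q ≤ 1 - c := by
    rcases (𝒞 ×ˢ {X : Matrix m m ℂ | IsState X}).eq_empty_or_nonempty with he | hne
    · exact ⟨1, one_pos, le_rfl, by simp [he]⟩
    · obtain ⟨q₀, hq₀, hmax⟩ := hK.exists_isMaxOn hne (hF k).continuousOn
      refine ⟨1 - F k q₀, sub_pos.2 (hk q₀ hq₀), ?_, fun q hq => ?_⟩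
      · have : 0 ≤ F k q₀ := escape_nonneg hP ((hch _ hq₀.1).pow_posSemidef k hq₀.2.1)
        linarith
      · have : F k q ≤ F k q₀ := hmax hq
        linarith
  refine ⟨k, c, hc0, hc1, fun T hT X hX => ?_⟩
  -- By homogeneity, the bound on states gives the bound `(1 - c) tr Y` for positive `Y`, and
  -- vanishing at `P` replaces the trace by the escape mass.
  refine (posOn_escapeAfter hP (hch T hT) k).le_mul_escape hP
    (by rw [escapeAfter_apply, pow_apply_fixed (hTP T hT), escape_self hP]) (fun Y hY => ?_) hX
  rcases (posOn_reTrace Y hY).eq_or_lt with h0 | h0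
  · rw [eq_zero_of_trace_eq_zero hY h0.symm]
    simp
  · have h1 := hc (T, Y.trace.re⁻¹ • Y) ⟨hT, isState_normalize hY h0⟩
    have h2 : F k (T, Y.trace.re⁻¹ • Y) = Y.trace.re⁻¹ * escapeAfter P T k Y := by
      rw [← smul_eq_mul, ← map_smul]
      rfl
    rw [h2, inv_mul_le_iff₀ (by exact h0)] at h1
    linarith

/-- The Lyapunov functional `∑_{j < k} escape P (T^j X)`. -/
def lyapunov (P : Matrix m m ℂ) (T : SuperOp m m) (k : ℕ) : Matrix m m ℂ →ₗ[ℝ] ℝ :=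
  ∑ j ∈ Finset.range k, escapeAfter P T j

lemma lyapunov_apply (P : Matrix m m ℂ) (T : SuperOp m m) (k : ℕ) (X : Matrix m m ℂ) :
    lyapunov P T k X = ∑ j ∈ Finset.range k, escape P ((T ^ j) X) := by
  simp [lyapunov, LinearMap.sum_apply]

/-! ### A functional that contracts at every step, and its stability under perturbation -/

section Lyapunov

variable {P : Matrix m m ℂ} (hP : IsPure P) {T : SuperOp m m} (hT : IsChannel T)
include hP hT

lemma posOn_lyapunov (k : ℕ) : PosOn (lyapunov P T k) := fun X hX => by
  rw [lyapunov_apply]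
  exact Finset.sum_nonneg fun j _ => escape_nonneg hP (hT.pow_posSemidef j hX)

lemma lyapunov_le_reTrace (k : ℕ) {X : Matrix m m ℂ} (hX : X.PosSemidef) :
    lyapunov P T k X ≤ k * X.trace.re := by
  rw [lyapunov_apply]
  refine (Finset.sum_le_card_nsmul _ _ X.trace.re fun j _ => ?_).trans (by simp)
  rw [← hT.pow_trace j X]
  exact escape_le_reTrace hP (hT.pow_posSemidef j hX)

lemma escape_le_lyapunov {k : ℕ} (hk : 0 < k) {X : Matrix m m ℂ} (hX : X.PosSemidef) :
    escape P X ≤ lyapunov P T k X := by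
  rw [lyapunov_apply]
  have := Finset.single_le_sum (f := fun j => escape P ((T ^ j) X))
    (fun j _ => escape_nonneg hP (hT.pow_posSemidef j hX)) (Finset.mem_range.2 hk)
  simpa only [pow_zero, one_apply_eq_self] using this

/-- Applying `T` shifts the sum: the first term is replaced by the `k`-th, a loss of at least `c *
escape P X`. By monotonicity the whole sum is at most `k * escape P X`. -/
lemma lyapunov_map_le (hTP : T P = P) {k : ℕ} (hk : 0 < k) {c : ℝ} (hc : 0 < c)
    {X : Matrix m m ℂ} (hX : X.PosSemidef) (h : escape P ((T ^ k) X) ≤ (1 - c) * escape P X) :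
    lyapunov P T k (T X) ≤ (1 - c / k) * lyapunov P T k X := by
  have h1 : lyapunov P T k (T X) = lyapunov P T k X + escape P ((T ^ k) X) - escape P X := by
    have e : ∀ j, (T ^ j) (T X) = (T ^ (j + 1)) X := fun j => by
      rw [pow_succ, mul_apply_eq_comp]
    have := Finset.sum_range_succ (fun j => escape P ((T ^ j) X)) k
    have h' := Finset.sum_range_succ' (fun j => escape P ((T ^ j) X)) k
    simp only [pow_zero, one_apply_eq_self] at h'
    simp only [lyapunov_apply, e]
    linarith
  have h2 : lyapunov P T k X ≤ k * escape P X := by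
    rw [lyapunov_apply]
    refine (Finset.sum_le_card_nsmul _ _ (escape P X) fun j _ => ?_).trans (by simp)
    simpa using escape_pow_antitone hP hT hTP hX (Nat.zero_le j)
  have hk' : (0 : ℝ) < k := by exact_mod_cast hk
  have h3 : c / k * lyapunov P T k X ≤ c * escape P X := by
    rw [div_mul_eq_mul_div, div_le_iff₀ hk']
    nlinarith
  linarith

end Lyapunov

/-- Interleaving `T` with unitaries `1 + D` close to the identity keeps the escape mass small,
of the order of the square of the deviation. -/
lemma exists_escape_bound {P : Matrix m m ℂ} (hP : IsPure P) {𝒞 : Set (SuperOp m m)}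
    (hclosed : IsClosed 𝒞) (hch : ∀ T ∈ 𝒞, IsChannel T)
    (hfix : ∀ T ∈ 𝒞, ∀ ρ, IsState ρ → (T ρ = ρ ↔ ρ = P)) :
    ∃ K : ℝ, 0 ≤ K ∧ ∀ T ∈ 𝒞, ∀ (D : Matrix m m ℂ) (δ : ℝ), (1 + D)ᴴ * (1 + D) = 1 →
      (∀ X : Matrix m m ℂ, X.PosSemidef → (D * X * Dᴴ).trace.re ≤ δ * X.trace.re) → 0 ≤ δ →
      ∀ σ : ℕ → Matrix m m ℂ, σ 0 = P →
        (∀ n, σ (n + 1) = (1 + D) * T (σ n) * (1 + D)ᴴ) →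
        ∀ n, IsState (σ n) ∧ escape P (σ n) ≤ K * δ := by
  obtain ⟨k₀, c, hc0, hc1, hc⟩ := exists_uniform_escape_le hP hclosed hch hfix
  have hTP : ∀ T ∈ 𝒞, T P = P := fun T hT => (hfix T hT P hP.isState).2 rfl
  -- The sum must be nonempty to dominate the escape mass; enlarging `k₀` keeps the contraction
  -- because the escape mass decreases along the orbit.
  set k := k₀ + 1
  have hk : 0 < k := Nat.succ_pos k₀
  have hk1 : (1 : ℝ) ≤ k := by exact_mod_cast hk
  set r : ℝ := 1 - c / k
  have hck : 0 < c / k := by positivity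
  have hck1 : c / k ≤ 1 := (div_le_one (by positivity)).2 (hc1.trans hk1)
  -- With `r = 1 - 2s`, the product `(1 + s) r` is at most `1 - s`. `K` then solves `(1 - s) K + (1
  -- + s⁻¹) k = K`, so `K * δ` is preserved by the recursion.
  set s : ℝ := (1 - r) / 2
  have hs : 0 < s := by simp only [s, r]; linarith
  set K : ℝ := (1 + s⁻¹) * k / s
  refine ⟨K, by positivity, fun T hT D δ hU hD hδ σ h0 hσ => ?_⟩
  have hst : ∀ n, IsState (σ n) := fun n => by
    induction n with
    | zero => rw [h0]; exact hP.isState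
    | succ n ih =>
      rw [hσ, ← conjOp_apply]
      exact (isChannel_conjOp hU).map_isState ((hch T hT).map_isState ih)
  have hL : ∀ n, lyapunov P T k (σ n) ≤ K * δ := fun n => by
    induction n with
    | zero =>
      have : lyapunov P T k P = 0 := by
        rw [lyapunov_apply]
        exact Finset.sum_eq_zero fun j _ => by rw [pow_apply_fixed (hTP T hT), escape_self hP]
      rw [h0, this]
      positivity
    | succ n ih =>
      have hX := hst n
      have hTX := (hch T hT).map_isState hX
      have h1 := (posOn_lyapunov hP (hch T hT) k).conj_add_le hTX.1 1 D hs
      rw [← hσ, Matrix.one_mul, Matrix.conjTranspose_one, Matrix.mul_one] at h1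
      have h2 : lyapunov P T k (T (σ n)) ≤ r * lyapunov P T k (σ n) := by
        refine lyapunov_map_le hP (hch T hT) (hTP T hT) hk hc0 hX.1 ?_
        exact (escape_pow_antitone hP (hch T hT) (hTP T hT) hX.1 (Nat.le_succ k₀)).trans
          (hc T hT _ hX.1)
      have h3 : lyapunov P T k (D * T (σ n) * Dᴴ) ≤ k * δ := by
        refine (lyapunov_le_reTrace hP (hch T hT) k (hTX.1.mul_mul_conjTranspose_same D)).trans ?_
        have := hD _ hTX.1
        rw [hTX.2, Complex.one_re, mul_one] at this
        gcongr
      have hr : 0 ≤ r := by simp only [r]; linarith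
      have hr' : r = 1 - 2 * s := by simp only [s]; ring
      have h4 : (1 + s) * lyapunov P T k (T (σ n)) ≤ (1 - s) * (K * δ) := by
        have h5 : lyapunov P T k (T (σ n)) ≤ r * (K * δ) := h2.trans (by gcongr)
        have hKδ : 0 ≤ K * δ := by positivity
        calc _ ≤ (1 + s) * (r * (K * δ)) := by gcongr
          _ ≤ (1 - s) * (K * δ) := by
            rw [← mul_assoc]
            gcongr
            rw [hr']
            nlinarith
      have h6 : (1 + s⁻¹) * lyapunov P T k (D * T (σ n) * Dᴴ) ≤ (1 + s⁻¹) * (k * δ) := by gcongr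
      have h7 : (1 + s⁻¹) * (k * δ) = s * (K * δ) := by
        simp only [K]
        field_simp
      linarith
  exact fun n => ⟨hst n, (escape_le_lyapunov hP (hch T hT) hk (hst n).1).trans (hL n)⟩

end QDisc
end

noncomputable section

namespace QDisc

/-! ### Trace norm, dual norm, and transmission bounded by escape mass -/

section DualNorm

variable {m : Type u} [Fintype m] [DecidableEq m]

open scoped MatrixOrder Matrix.Norms.L2Operator in
lemma traceNorm_of_posSemidef {X : Matrix m m ℂ} (hX : X.PosSemidef) :
    traceNorm X = X.trace.re := by
  rw [traceNorm, CFC.abs_of_nonneg X (Matrix.nonneg_iff_posSemidef.2 hX)]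

open scoped MatrixOrder Matrix.Norms.L2Operator in
lemma norm_entry_le_traceNorm (X : Matrix m m ℂ) (i j : m) :
    ‖X i j‖ ^ 2 ≤ Fintype.card m * traceNorm X ^ 2 := by
  set B := CFC.abs X with hB
  have hBpos : B.PosSemidef := Matrix.nonneg_iff_posSemidef.1 (CFC.abs_nonneg X)
  have h : B * B = Xᴴ * X := CFC.abs_mul_abs X
  have h1 : ∀ A : Matrix m m ℂ, ((Aᴴ * A) j j).re = ∑ k, ‖A k j‖ ^ 2 := fun A => by
    rw [Matrix.mul_apply, Complex.re_sum]
    refine Finset.sum_congr rfl fun k _ => ?_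
    rw [Matrix.conjTranspose_apply, ← Complex.normSq_eq_norm_sq, Complex.normSq_apply]
    simp
  -- As `Xᴴ X = |X|²`, corresponding columns of `X` and `|X|` have the same Euclidean norm.
  have h2 : ∑ k, ‖X k j‖ ^ 2 = ∑ k, ‖B k j‖ ^ 2 := by
    rw [← h1, ← h1, hBpos.1.eq, h]
  calc ‖X i j‖ ^ 2 ≤ ∑ k, ‖X k j‖ ^ 2 :=
        Finset.single_le_sum (f := fun k => ‖X k j‖ ^ 2) (fun _ _ => by positivity)
          (Finset.mem_univ i)
    _ = ∑ k, ‖B k j‖ ^ 2 := h2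
    _ ≤ ∑ _k : m, traceNorm X ^ 2 := by
        gcongr with k
        exact norm_entry_le_trace hBpos k j
    _ = Fintype.card m * traceNorm X ^ 2 := by simp

lemma traceNorm_nonneg (X : Matrix m m ℂ) : 0 ≤ traceNorm X := by
  open scoped MatrixOrder Matrix.Norms.L2Operator in
  exact posOn_reTrace _ (Matrix.nonneg_iff_posSemidef.1 (CFC.abs_nonneg X))

/-- An unbounded set would have `sSup` equal to `0`; boundedness makes `dualNorm t` an actual upper
bound. -/
lemma bddAbove_dualNorm (t : Matrix m m ℂ →L[ℂ] ℂ) :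
    BddAbove {r : ℝ | ∃ A : Matrix m m ℂ, traceNorm A ≤ 1 ∧ r = ‖t A‖} := by
  refine ⟨∑ i, ∑ j, √(Fintype.card m) * ‖t (Matrix.single i j 1)‖, ?_⟩
  rintro _ ⟨A, hA, rfl⟩
  conv_lhs => rw [Matrix.matrix_eq_sum_single A]
  rw [map_sum]
  refine (norm_sum_le _ _).trans (Finset.sum_le_sum fun i _ => ?_)
  rw [map_sum]
  refine (norm_sum_le _ _).trans (Finset.sum_le_sum fun j _ => ?_)
  have e : Matrix.single i j (A i j) = A i j • Matrix.single i j (1 : ℂ) := by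
    rw [Matrix.smul_single, smul_eq_mul, mul_one]
  rw [e, map_smul, norm_smul]
  gcongr
  refine Real.le_sqrt_of_sq_le ((norm_entry_le_traceNorm A i j).trans ?_)
  have := pow_le_one₀ (n := 2) (traceNorm_nonneg A) hA
  nlinarith [(Nat.cast_nonneg (Fintype.card m) : (0 : ℝ) ≤ _)]

lemma dualNorm_nonneg (t : Matrix m m ℂ →L[ℂ] ℂ) : 0 ≤ dualNorm t :=
  Real.sSup_nonneg (by rintro _ ⟨A, -, rfl⟩; exact norm_nonneg _)

/-- The real part of a functional, as a real-linear functional. -/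
def reFun (t : Matrix m m ℂ →L[ℂ] ℂ) : Matrix m m ℂ →ₗ[ℝ] ℝ :=
  Complex.reLm ∘ₗ t.toLinearMap.restrictScalars ℝ

omit [Fintype m] [DecidableEq m] in
@[simp] lemma reFun_apply (t : Matrix m m ℂ →L[ℂ] ℂ) (X : Matrix m m ℂ) :
    reFun t X = (t X).re := rfl

lemma re_le_dualNorm_mul_trace (t : Matrix m m ℂ →L[ℂ] ℂ) {X : Matrix m m ℂ} (hX : X.PosSemidef) :
    reFun t X ≤ dualNorm t * X.trace.re := by
  rcases (posOn_reTrace X hX).eq_or_lt with h0 | h0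
  · rw [eq_zero_of_trace_eq_zero hX h0.symm]
    simp
  · rw [reTrace_apply] at h0
    have hs := isState_normalize hX h0
    have h1 : ‖t (X.trace.re⁻¹ • X)‖ ≤ dualNorm t :=
      le_csSup (bddAbove_dualNorm t) ⟨_, by rw [traceNorm_of_posSemidef hs.1, hs.2]; simp, rfl⟩
    have h2 : X.trace.re⁻¹ * reFun t X = reFun t (X.trace.re⁻¹ • X) := by
      rw [map_smul, smul_eq_mul]
    have h3 := (h2.le.trans (Complex.re_le_norm _)).trans h1
    rw [inv_mul_le_iff₀ h0] at h3
    linarith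

lemma re_le_dualNorm_mul_escape {P : Matrix m m ℂ} (hP : IsPure P) {t : Matrix m m ℂ →L[ℂ] ℂ}
    (ht : IsPositiveFunctional t) (h0 : t P = 0) {X : Matrix m m ℂ} (hX : X.PosSemidef) :
    (t X).re ≤ dualNorm t * escape P X :=
  PosOn.le_mul_escape hP (g := reFun t) (fun Y hY => (Complex.le_def.1 (ht Y hY)).1)
    (by simp [h0]) (fun _ hY => re_le_dualNorm_mul_trace t hY) hX

end DualNorm

/-! ### Rotations in the plane of two orthonormal vectors -/

section Rotation

variable {m : Type u} [Fintype m] [DecidableEq m]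

omit [DecidableEq m] in
lemma isPure_vecMulVec {x : m → ℂ} (hx : star x ⬝ᵥ x = 1) : IsPure (Matrix.vecMulVec x (star x)) where
  herm := by rw [Matrix.conjTranspose_vecMulVec, star_star]
  idem := by rw [Matrix.vecMulVec_mul_vecMulVec, hx, one_smul]
  trace := by rw [Matrix.trace_vecMulVec, dotProduct_comm, hx]
  compress X := by
    rw [Matrix.mul_assoc, Matrix.mul_vecMulVec, Matrix.vecMulVec_mul_vecMulVec,
      Matrix.vecMulVec_mul, Matrix.trace_vecMulVec, dotProduct_comm x,
      ← Matrix.dotProduct_mulVec, dotProduct_comm (star x), Matrix.vecMulVec_smul]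

omit [DecidableEq m] in
lemma star_dotProduct_swap {x y : m → ℂ} (hxy : star x ⬝ᵥ y = 0) : star y ⬝ᵥ x = 0 := by
  have := congrArg star hxy
  rwa [Matrix.star_dotProduct, star_star, star_zero] at this

/-- The deviation from the identity of the rotation by `θ` from `x` towards `y`. -/
def rotDev (x y : m → ℂ) (θ : ℝ) : Matrix m m ℂ :=
  ((Real.cos θ - 1 : ℝ) : ℂ) • (Matrix.vecMulVec x (star x) + Matrix.vecMulVec y (star y)) +
    ((Real.sin θ : ℝ) : ℂ) • (Matrix.vecMulVec y (star x) - Matrix.vecMulVec x (star y))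

variable {x y : m → ℂ} (hx : star x ⬝ᵥ x = 1) (hy : star y ⬝ᵥ y = 1) (hxy : star x ⬝ᵥ y = 0)
include hx hy hxy

lemma rotDev_conjTranspose_mul (θ : ℝ) : (rotDev x y θ)ᴴ * rotDev x y θ =
    ((2 - 2 * Real.cos θ : ℝ) : ℂ) •
      (Matrix.vecMulVec x (star x) + Matrix.vecMulVec y (star y)) := by
  have hyx := star_dotProduct_swap hxy
  have h : ((Real.cos θ : ℝ) : ℂ) ^ 2 + ((Real.sin θ : ℝ) : ℂ) ^ 2 = 1 := by
    exact_mod_cast Real.cos_sq_add_sin_sq θ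
  simp only [rotDev, Matrix.conjTranspose_add, Matrix.conjTranspose_sub, Matrix.conjTranspose_smul,
    Matrix.conjTranspose_vecMulVec, star_star, Complex.star_def, Complex.conj_ofReal, mul_add,
    add_mul, mul_sub, sub_mul, smul_mul_assoc, mul_smul_comm, Matrix.vecMulVec_mul_vecMulVec, hx,
    hy, hxy, hyx, one_smul, zero_smul, Matrix.vecMulVec_zero]
  push_cast at h ⊢
  ext i j
  simp only [Matrix.add_apply, Matrix.sub_apply, Matrix.smul_apply, smul_eq_mul, Matrix.zero_apply]
  linear_combination (Matrix.vecMulVec x (star x) i j + Matrix.vecMulVec y (star y) i j) * h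

lemma rotDev_unitary (θ : ℝ) : (1 + rotDev x y θ)ᴴ * (1 + rotDev x y θ) = 1 := by
  have h := rotDev_conjTranspose_mul hx hy hxy θ
  -- The antisymmetric sine part cancels in `D + Dᴴ`, which leaves exactly `-Dᴴ D`.
  rw [Matrix.conjTranspose_add, Matrix.conjTranspose_one, add_mul, mul_add, mul_add, h]
  ext i j
  simp only [rotDev, Matrix.conjTranspose_add, Matrix.conjTranspose_sub, Matrix.conjTranspose_smul,
    Matrix.conjTranspose_vecMulVec, star_star, Complex.star_def, Complex.conj_ofReal,
    Matrix.add_apply, Matrix.sub_apply, Matrix.smul_apply, smul_eq_mul, one_mul, mul_one]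
  push_cast
  ring

/-- `Dᴴ D` is `2 - 2 cos θ ≤ θ²` times the projection onto the plane. This is the `δ = θ²` of
`exists_escape_bound`. -/
lemma rotDev_trace_le (θ : ℝ) {X : Matrix m m ℂ} (hX : X.PosSemidef) :
    (rotDev x y θ * X * (rotDev x y θ)ᴴ).trace.re ≤ θ ^ 2 * X.trace.re := by
  have hyx := star_dotProduct_swap hxy
  set R := Matrix.vecMulVec x (star x) + Matrix.vecMulVec y (star y) with hR
  have hRR : R * R = R := by
    simp [hR, add_mul, mul_add, Matrix.vecMulVec_mul_vecMulVec, hx, hy, hxy, hyx]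
  have hRh : Rᴴ = R := by simp [hR, Matrix.conjTranspose_vecMulVec]
  have h1 : pairing R X ≤ X.trace.re := by
    have := pairing_le_pairing (A := R) (B := 1) (by simp [sub_mul, mul_sub, hRR]) (by simp [hRh]) hX
    simpa using this
  have h0 := posOn_pairing hRR hRh X hX
  rw [Matrix.trace_mul_comm, ← Matrix.mul_assoc, rotDev_conjTranspose_mul hx hy hxy,
    Matrix.smul_mul, Matrix.trace_smul, smul_eq_mul, Complex.re_ofReal_mul]
  rw [pairing_apply] at h0 h1
  have h2 := Real.one_sub_sq_div_two_le_cos (x := θ)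
  calc _ ≤ θ ^ 2 * (R * X).trace.re := by gcongr; linarith
    _ ≤ _ := by gcongr

lemma rot_mulVec (θ φ : ℝ) : (1 + rotDev x y θ) *ᵥ
    (((Real.cos φ : ℝ) : ℂ) • x + ((Real.sin φ : ℝ) : ℂ) • y) =
    ((Real.cos (θ + φ) : ℝ) : ℂ) • x + ((Real.sin (θ + φ) : ℝ) : ℂ) • y := by
  have hyx := star_dotProduct_swap hxy
  have hm : ∀ a b c : m → ℂ, Matrix.vecMulVec a b *ᵥ c = (b ⬝ᵥ c) • a := fun a b c => by
    ext i
    simp [Matrix.vecMulVec_mulVec, mul_comm]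
  simp only [rotDev, Matrix.add_mulVec, Matrix.sub_mulVec, Matrix.smul_mulVec, Matrix.mulVec_add,
    Matrix.mulVec_smul, Matrix.one_mulVec, hm, hx, hy, hxy, hyx, one_smul, zero_smul]
  ext i
  simp only [Pi.add_apply, Pi.sub_apply, Pi.smul_apply, smul_eq_mul, Real.cos_add, Real.sin_add,
    Pi.zero_apply]
  push_cast
  ring

end Rotation

/-! ### The ancilla-free strategy that repeats one unitary -/

section Strategy

variable {ι : Type u} [Fintype ι] [DecidableEq ι]

variable (ι) in
/-- The isometry `ℂ^ι → ℂ^ι ⊗ ℂ`. -/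
def attach : Matrix (ι × PUnit.{u + 1}) ι ℂ := (1 : Matrix ι ι ℂ).submatrix Prod.fst id

lemma attach_conjTranspose_mul : (attach ι)ᴴ * attach ι = 1 := by
  ext i j
  simp [attach, Matrix.mul_apply, Fintype.sum_prod_type, Matrix.one_apply, apply_ite]

lemma attach_mul_conjTranspose : attach ι * (attach ι)ᴴ = 1 := by
  ext ⟨i, a⟩ ⟨j, b⟩
  simp [attach, Matrix.mul_apply, Matrix.one_apply, apply_ite]

/-- The operator `X`, transported to `ℂ^ι ⊗ ℂ`. -/
def lift (X : Matrix ι ι ℂ) : Matrix (ι × PUnit.{u + 1}) (ι × PUnit.{u + 1}) ℂ :=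
  attach ι * X * (attach ι)ᴴ

lemma lift_apply (X : Matrix ι ι ℂ) (p q : ι × PUnit.{u + 1}) : lift X p q = X p.1 q.1 := by
  simp [lift, attach, Matrix.mul_apply, Matrix.one_apply, apply_ite]

lemma ampl_lift (T : SuperOp ι ι) (X : Matrix ι ι ℂ) : ampl T (lift X) = lift (T X) := by
  ext p q
  simp only [ampl, lift_apply, Matrix.of_apply]
  rfl

lemma ptrace_lift (X : Matrix ι ι ℂ) : ptrace (lift X) = X := by
  ext i j
  simp [ptrace, lift_apply]

lemma lift_mul (X Y : Matrix ι ι ℂ) : lift X * lift Y = lift (X * Y) := by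
  calc lift X * lift Y = attach ι * (X * ((attach ι)ᴴ * attach ι) * Y) * (attach ι)ᴴ := by
        simp only [lift, Matrix.mul_assoc]
    _ = lift (X * Y) := by rw [attach_conjTranspose_mul, Matrix.mul_one, lift]

lemma lift_conjTranspose (X : Matrix ι ι ℂ) : (lift X)ᴴ = lift Xᴴ := by
  simp only [lift, Matrix.conjTranspose_mul, Matrix.conjTranspose_conjTranspose, Matrix.mul_assoc]

lemma lift_one : lift (1 : Matrix ι ι ℂ) = 1 := by
  rw [lift, Matrix.mul_one, attach_mul_conjTranspose]

lemma detach_lift (X : Matrix ι ι ℂ) : (attach ι)ᴴ * lift X * attach ι = X := by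
  calc _ = ((attach ι)ᴴ * attach ι) * X * ((attach ι)ᴴ * attach ι) := by
        simp only [lift, Matrix.mul_assoc]
    _ = X := by rw [attach_conjTranspose_mul, Matrix.mul_one, Matrix.one_mul]

/-- The strategy with trivial ancilla that starts in `P` and applies the unitary `U` after each
use of the unknown channel. -/
def repeatStrategy (N : ℕ) (hN : 1 ≤ N) {P U : Matrix ι ι ℂ} (hP : IsState P) (hU : Uᴴ * U = 1) :
    Strategy ι N where
  one_le := hN
  Z := PUnit
  I := ι
  O := ι
  s₀ := P
  first := conjOp (attach ι)
  mid _ := conjOp (lift U)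
  -- The last channel also applies `U`, so that `N` uses come with `N` rotations.
  last := conjOp (U * (attach ι)ᴴ)
  isState := hP
  first_channel := isChannel_conjOp attach_conjTranspose_mul
  mid_channel _ _ _ := isChannel_conjOp (by rw [lift_conjTranspose, lift_mul, hU, lift_one])
  last_channel := isChannel_conjOp (by
    rw [Matrix.conjTranspose_mul, Matrix.conjTranspose_conjTranspose, Matrix.mul_assoc,
      ← Matrix.mul_assoc Uᴴ, hU, Matrix.one_mul, attach_mul_conjTranspose])

/-- The reduced states `P, U T(P) Uᴴ, …`. -/
def orbit (P U : Matrix ι ι ℂ) (T : SuperOp ι ι) : ℕ → Matrix ι ι ℂ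
  | 0 => P
  | n + 1 => U * T (orbit P U T n) * Uᴴ

variable {N : ℕ} (hN : 1 ≤ N) {P U : Matrix ι ι ℂ} (hP : IsState P) (hU : Uᴴ * U = 1)

lemma interState_repeatStrategy (T : SuperOp ι ι) (n : ℕ) :
    (repeatStrategy N hN hP hU).interState T n = lift (orbit P U T n) := by
  induction n with
  | zero => rfl
  | succ n ih =>
    rw [Strategy.interState, ih]
    change conjOp (lift U) (ampl T (lift (orbit P U T n))) = _
    rw [ampl_lift, conjOp_apply, lift_conjTranspose, lift_mul, lift_mul, orbit]

lemma finalState_repeatStrategy (T : SuperOp ι ι) :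
    (repeatStrategy N hN hP hU).finalState T = (orbit P U T N : Matrix ι ι ℂ) := by
  obtain ⟨n, rfl⟩ : ∃ n, N = n + 1 := ⟨N - 1, by omega⟩
  unfold Strategy.finalState
  rw [interState_repeatStrategy]
  change conjOp (U * (attach ι)ᴴ) (ampl T (lift (orbit P U T n))) = _
  rw [ampl_lift, conjOp_apply, orbit, Matrix.conjTranspose_mul,
    Matrix.conjTranspose_conjTranspose]
  calc _ = U * ((attach ι)ᴴ * lift (T (orbit P U T n)) * attach ι) * Uᴴ := by
        simp only [Matrix.mul_assoc]
    _ = _ := by rw [detach_lift]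

lemma errorProb_repeatStrategy (𝒜 ℬ : Set (SuperOp ι ι)) (M : POVM₂ ι) :
    errorProb 𝒜 ℬ (repeatStrategy N hN hP hU) M =
      (1 / 2) * (sSup ((fun T => (M.B * orbit P U T N).trace.re) '' 𝒜) +
        sSup ((fun T => (M.A * orbit P U T N).trace.re) '' ℬ)) :=
  congrArg₂ (fun f g : SuperOp ι ι → ℝ => (1 / 2) * (sSup (f '' 𝒜) + sSup (g '' ℬ)))
    (funext fun T => congrArg (fun X : Matrix ι ι ℂ => (M.B * X).trace.re)
      (finalState_repeatStrategy hN hP hU T))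
    (funext fun T => congrArg (fun X : Matrix ι ι ℂ => (M.A * X).trace.re)
      (finalState_repeatStrategy hN hP hU T))

lemma totalTransmission_repeatStrategy (T : SuperOp ι ι) (t : Matrix ι ι ℂ →L[ℂ] ℂ) :
    (repeatStrategy N hN hP hU).totalTransmission T t =
      ∑ n ∈ Finset.range N, (t (orbit P U T n)).re := by
  refine Finset.sum_congr rfl fun n _ => ?_
  rw [interState_repeatStrategy]
  exact congrArg (fun X => (t X).re) (ptrace_lift _)

omit [DecidableEq ι] in
lemma orbit_id_vecMulVec (x : ℕ → ι → ℂ) (hx : ∀ n, U *ᵥ x n = x (n + 1)) (n : ℕ) :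
    orbit (Matrix.vecMulVec (x 0) (star (x 0))) U (ContinuousLinearMap.id ℂ _) n =
      Matrix.vecMulVec (x n) (star (x n)) := by
  induction n with
  | zero => rfl
  | succ n ih =>
    rw [orbit, ih, ContinuousLinearMap.id_apply, Matrix.mul_vecMulVec, Matrix.vecMulVec_mul, hx,
      ← Matrix.star_mulVec, hx]

end Strategy

end QDisc
end

/-! ### Choice of the rotation and the final estimates -/

noncomputable section

namespace QDisc

variable {ι : Type u} [Fintype ι] [DecidableEq ι]

omit [DecidableEq ι] in
lemma star_dotProduct_self_of_norm {v : EuclideanSpace ℂ ι} (hv : ‖v‖ = 1) :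
    star v.ofLp ⬝ᵥ v.ofLp = 1 := by
  rw [dotProduct_comm, ← EuclideanSpace.inner_eq_star_dotProduct, inner_self_eq_norm_sq_to_K, hv]
  simp

/-- Without such a `y` the projection onto `x` is `1`, every operator is a multiple of it, and a map
fixing it is the identity. -/
lemma exists_orthogonal_unit {x : ι → ℂ} (hx : star x ⬝ᵥ x = 1) {T : SuperOp ι ι}
    (hT : T (Matrix.vecMulVec x (star x)) = Matrix.vecMulVec x (star x))
    (hne : T ≠ ContinuousLinearMap.id ℂ _) : ∃ y : ι → ℂ, star y ⬝ᵥ y = 1 ∧ star x ⬝ᵥ y = 0 := by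
  have hP := isPure_vecMulVec hx
  by_contra! hcon
  have h1 : ∀ z : ι → ℂ, star x ⬝ᵥ z = 0 → z = 0 := fun z hz => by
    by_contra hz0
    have hpos : 0 < star z ⬝ᵥ z := Matrix.dotProduct_star_self_pos_iff.2 hz0
    have hre : star z ⬝ᵥ z = ((star z ⬝ᵥ z).re : ℂ) :=
      Complex.ext rfl (by simpa using (Complex.lt_def.1 hpos).2.symm)
    have hre0 : 0 < (star z ⬝ᵥ z).re := (Complex.lt_def.1 hpos).1
    set a := (star z ⬝ᵥ z).re
    refine hcon (((√a)⁻¹ : ℝ) • z) ?_ ?_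
    · rw [star_smul, smul_dotProduct, dotProduct_smul, hre, smul_smul, star_trivial,
        ← mul_inv, Real.mul_self_sqrt hre0.le, Complex.real_smul, ← Complex.ofReal_mul,
        inv_mul_cancel₀ hre0.ne', Complex.ofReal_one]
    · rw [dotProduct_smul, hz, smul_zero]
  have h2 : Matrix.vecMulVec x (star x) = 1 := by
    refine (sub_eq_zero.1 (Matrix.ext_of_mulVec_single fun j => ?_)).symm
    rw [Matrix.zero_mulVec]
    refine h1 _ ?_
    rw [Matrix.dotProduct_mulVec, Matrix.vecMul_sub, Matrix.vecMul_one, Matrix.vecMul_vecMulVec,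
      hx, one_smul, sub_self, zero_dotProduct]
  refine hne (ContinuousLinearMap.ext fun X => ?_)
  have h3 := hP.compress X
  rw [h2, Matrix.one_mul, Matrix.mul_one] at h3
  rw [h2] at hT
  rw [h3, map_smul, hT]
  rfl

/-- The POVM detecting the projection `R`. -/
def povmOfIdem {O : Type u} [Fintype O] [DecidableEq O] {R : Matrix O O ℂ} (hR : R * R = R)
    (hR' : Rᴴ = R) : POVM₂ O where
  A := R
  B := 1 - R
  posA := by
    have := Matrix.posSemidef_self_mul_conjTranspose R
    rwa [hR', hR] at this
  posB := by
    have := Matrix.posSemidef_self_mul_conjTranspose (1 - R)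
    simpa [sub_mul, mul_sub, hR, hR'] using this
  add_eq_one := add_sub_cancel R 1

lemma exists_strategy_of_orthogonal {x y : ι → ℂ} (hx : star x ⬝ᵥ x = 1) (hy : star y ⬝ᵥ y = 1)
    (hxy : star x ⬝ᵥ y = 0) {𝒞 : Set (SuperOp ι ι)} (hclosed : IsClosed 𝒞)
    (hch : ∀ T ∈ 𝒞, IsChannel T)
    (hfix : ∀ T ∈ 𝒞, ∀ ρ, IsState ρ → (T ρ = ρ ↔ ρ = Matrix.vecMulVec x (star x))) :
    ∃ C : ℝ, ∀ N : ℕ, 1 ≤ N → ∃ (D : Strategy ι N) (P : POVM₂ D.O),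
      errorProb {ContinuousLinearMap.id ℂ (Matrix ι ι ℂ)} 𝒞 D P ≤ C / (N : ℝ) ^ 2 ∧
      ∀ T ∈ 𝒞, ∀ t : Matrix ι ι ℂ →L[ℂ] ℂ, IsPositiveFunctional t →
        t (Matrix.vecMulVec x (star x)) = 0 →
        D.totalTransmission T t ≤ C * dualNorm t / (N : ℝ) := by
  have hP := isPure_vecMulVec hx
  have hR := isPure_vecMulVec hy
  have hyx := star_dotProduct_swap hxy
  obtain ⟨K, hK0, hK⟩ := exists_escape_bound hP hclosed hch hfix
  refine ⟨K * (Real.pi / 2) ^ 2, fun N hN => ?_⟩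
  have hN0 : (0 : ℝ) < N := by exact_mod_cast hN
  -- `N` rotations by `θ` carry `x` exactly to `y`.
  set θ : ℝ := Real.pi / 2 / N with hθ
  have hU := rotDev_unitary hx hy hxy θ
  have hbound : ∀ T ∈ 𝒞, ∀ n, IsState (orbit (Matrix.vecMulVec x (star x)) (1 + rotDev x y θ) T n) ∧
      escape (Matrix.vecMulVec x (star x))
        (orbit (Matrix.vecMulVec x (star x)) (1 + rotDev x y θ) T n) ≤ K * θ ^ 2 := fun T hT =>
    hK T hT (rotDev x y θ) (θ ^ 2) hU (fun X hX => rotDev_trace_le hx hy hxy θ hX) (sq_nonneg θ) _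
      rfl fun _ => rfl
  have hKθ : K * θ ^ 2 = K * (Real.pi / 2) ^ 2 / (N : ℝ) ^ 2 := by
    rw [hθ, div_pow, mul_div_assoc]
  refine ⟨repeatStrategy N hN hP.isState hU, povmOfIdem (O := ι) hR.idem hR.herm, ?_, ?_⟩
  · have hid : orbit (Matrix.vecMulVec x (star x)) (1 + rotDev x y θ) (ContinuousLinearMap.id ℂ _) N
        = Matrix.vecMulVec y (star y) := by
      have h := orbit_id_vecMulVec (U := 1 + rotDev x y θ) (fun n : ℕ =>
        ((Real.cos (n * θ) : ℝ) : ℂ) • x + ((Real.sin (n * θ) : ℝ) : ℂ) • y) (fun n => by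
          rw [rot_mulVec hx hy hxy, Nat.cast_succ, add_mul, one_mul, add_comm θ]) N
      have hNθ : (N : ℝ) * θ = Real.pi / 2 := by
        rw [hθ]
        field_simp
      simp only [hNθ, Nat.cast_zero, zero_mul, Real.cos_zero, Real.sin_zero, Real.cos_pi_div_two,
        Real.sin_pi_div_two, Complex.ofReal_one, Complex.ofReal_zero, one_smul, zero_smul,
        add_zero, zero_add] at h
      exact h
    have hB : sSup ((fun T => (Matrix.vecMulVec y (star y) *
        orbit (Matrix.vecMulVec x (star x)) (1 + rotDev x y θ) T N).trace.re) '' 𝒞) ≤ K * θ ^ 2 := by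
      refine Real.sSup_le ?_ (by positivity)
      rintro _ ⟨T, hT, rfl⟩
      -- As `y` is orthogonal to `x`, the projection onto `y` lies below `1 - P`, so mistaking `T`
      -- for the identity is no more likely than escaping from `P`.
      refine le_trans (pairing_le_pairing ?_ ?_ (hbound T hT N).1.1) (hbound T hT N).2
      · simp [sub_mul, mul_sub, Matrix.vecMulVec_mul_vecMulVec, hx, hy, hxy, hyx]
      · simp [Matrix.conjTranspose_vecMulVec]
    have hpos : 0 ≤ K * θ ^ 2 := by positivity
    have hA : ((1 - Matrix.vecMulVec y (star y)) * Matrix.vecMulVec y (star y)).trace.re = 0 :=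
      escape_self hR
    rw [← hKθ, errorProb_repeatStrategy, Set.image_singleton, csSup_singleton, hid]
    simp only [povmOfIdem, hA]
    linarith
  · intro T hT t ht h0
    rw [totalTransmission_repeatStrategy]
    have h1 : ∀ n ∈ Finset.range N,
        (t (orbit (Matrix.vecMulVec x (star x)) (1 + rotDev x y θ) T n)).re ≤
          dualNorm t * (K * θ ^ 2) := fun n _ =>
      (re_le_dualNorm_mul_escape hP ht h0 (hbound T hT n).1.1).trans
        (mul_le_mul_of_nonneg_left (hbound T hT n).2 (dualNorm_nonneg t))
    -- `N` terms of order `1/N²` give the rate `1/N`.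
    refine (Finset.sum_le_card_nsmul _ _ _ h1).trans (le_of_eq ?_)
    rw [Finset.card_range, nsmul_eq_mul, hKθ]
    field_simp

lemma exists_strategy_empty {x : ι → ℂ} (hx : star x ⬝ᵥ x = 1) (N : ℕ) (hN : 1 ≤ N) :
    ∃ (D : Strategy ι N) (P : POVM₂ D.O),
      errorProb {ContinuousLinearMap.id ℂ (Matrix ι ι ℂ)} ∅ D P ≤ 0 := by
  refine ⟨repeatStrategy N hN (U := 1) (isPure_vecMulVec hx).isState (by simp),
    povmOfIdem (O := ι) (R := 1) (by simp) (by simp), ?_⟩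
  rw [errorProb_repeatStrategy]
  simp [povmOfIdem]

lemma transmissionFreeDiscriminable_of_bounds {𝒞 : Set (SuperOp ι ι)} {S : Matrix ι ι ℂ}
    {t : SuperOp ι ι → Matrix ι ι ℂ →L[ℂ] ℂ} (hid : t (ContinuousLinearMap.id ℂ _) = 0)
    (hpos : ∀ T ∈ 𝒞, IsPositiveFunctional (t T)) (hS : ∀ T ∈ 𝒞, t T S = 0)
    (hbdd : BddAbove ((fun T => dualNorm (t T)) '' 𝒞)) {C : ℝ}
    (hC : ∀ N : ℕ, 1 ≤ N → ∃ (D : Strategy ι N) (P : POVM₂ D.O),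
      errorProb {ContinuousLinearMap.id ℂ (Matrix ι ι ℂ)} 𝒞 D P ≤ C / (N : ℝ) ^ 2 ∧
      ∀ T ∈ 𝒞, ∀ t : Matrix ι ι ℂ →L[ℂ] ℂ, IsPositiveFunctional t → t S = 0 →
        D.totalTransmission T t ≤ C * dualNorm t / (N : ℝ)) :
    TransmissionFreeDiscriminable {ContinuousLinearMap.id ℂ (Matrix ι ι ℂ)} 𝒞 t := by
  intro ε δ hε hδ
  obtain ⟨M, hM⟩ := hbdd
  -- Absolute values are taken since neither `C` nor the bound `M` has a known sign. As `N > 1`,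
  -- `|C| < N ε` already gives `C / N² < ε`.
  obtain ⟨N, hN⟩ := exists_nat_gt (max 1 (max (|C| / ε) (|C| * |M| / δ)))
  have hN1 : (1 : ℝ) < N := (le_max_left _ _).trans_lt hN
  have hNε : |C| / ε < N := ((le_max_left _ _).trans (le_max_right _ _)).trans_lt hN
  have hNδ : |C| * |M| / δ < N := ((le_max_right _ _).trans (le_max_right _ _)).trans_lt hN
  have hN0 : (0 : ℝ) < N := one_pos.trans hN1
  rw [div_lt_iff₀ hε] at hNε
  rw [div_lt_iff₀ hδ] at hNδ
  obtain ⟨D, P, herr, htr⟩ := hC N (by exact_mod_cast hN1.le)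
  refine ⟨N, D, P, herr.trans_lt ?_, ?_⟩
  · rw [div_lt_iff₀ (by positivity)]
    nlinarith [le_abs_self C, mul_pos hε hN0]
  · rintro T (rfl | hT)
    · simpa [Strategy.totalTransmission, hid] using hδ
    · refine (htr T hT (t T) (hpos T hT) (hS T hT)).trans_lt ?_
      have h1 : dualNorm (t T) ≤ |M| := (hM ⟨T, hT, rfl⟩).trans (le_abs_self M)
      rw [div_lt_iff₀ hN0]
      calc C * dualNorm (t T) ≤ |C| * |M| :=
            mul_le_mul (le_abs_self C) h1 (dualNorm_nonneg _) (abs_nonneg C)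
        _ < δ * N := by rwa [mul_comm δ]

end QDisc

end

theorem theorem4p1 {ι : Type u} [Fintype ι] [DecidableEq ι]
    (𝒞 : Set (QDisc.SuperOp ι ι)) (h𝒞_closed : IsClosed 𝒞)
    (h𝒞_channel : ∀ T ∈ 𝒞, QDisc.IsChannel T)
    (v : EuclideanSpace ℂ ι) (hv : ‖v‖ = 1)
    (hfix : ∀ T ∈ 𝒞, ∀ ρ : Matrix ι ι ℂ, QDisc.IsState ρ → (T ρ = ρ ↔ ρ = QDisc.ketbra v))
    (hid : ContinuousLinearMap.id ℂ (Matrix ι ι ℂ) ∉ 𝒞) :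
    (∃ C : ℝ, ∀ N : ℕ, 1 ≤ N → ∃ (D : QDisc.Strategy ι N) (P : QDisc.POVM₂ D.O),
      QDisc.errorProb {ContinuousLinearMap.id ℂ (Matrix ι ι ℂ)} 𝒞 D P ≤ C / (N : ℝ) ^ 2 ∧
      ∀ T ∈ 𝒞, ∀ t : Matrix ι ι ℂ →L[ℂ] ℂ, QDisc.IsPositiveFunctional t →
        t (QDisc.ketbra v) = 0 →
        D.totalTransmission T t ≤ C * QDisc.dualNorm t / (N : ℝ)) ∧
    (∀ t : QDisc.SuperOp ι ι → Matrix ι ι ℂ →L[ℂ] ℂ,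
      t (ContinuousLinearMap.id ℂ (Matrix ι ι ℂ)) = 0 →
      (∀ T ∈ 𝒞, QDisc.IsPositiveFunctional (t T)) →
      (∀ T ∈ 𝒞, t T (QDisc.ketbra v) = 0) →
      BddAbove ((fun T => QDisc.dualNorm (t T)) '' 𝒞) →
      QDisc.TransmissionFreeDiscriminable {ContinuousLinearMap.id ℂ (Matrix ι ι ℂ)} 𝒞 t) := by
  have hx := QDisc.star_dotProduct_self_of_norm hv
  have hket : QDisc.ketbra v = Matrix.vecMulVec v.ofLp (star v.ofLp) := rfl
  have hmain : ∃ C : ℝ, ∀ N : ℕ, 1 ≤ N → ∃ (D : QDisc.Strategy ι N) (P : QDisc.POVM₂ D.O),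
      QDisc.errorProb {ContinuousLinearMap.id ℂ (Matrix ι ι ℂ)} 𝒞 D P ≤ C / (N : ℝ) ^ 2 ∧
      ∀ T ∈ 𝒞, ∀ t : Matrix ι ι ℂ →L[ℂ] ℂ, QDisc.IsPositiveFunctional t → t (QDisc.ketbra v) = 0 →
        D.totalTransmission T t ≤ C * QDisc.dualNorm t / (N : ℝ) := by
    -- For empty `𝒞` the space may be one-dimensional, without any `y`, and always answering
    -- "identity" makes no error. Otherwise `id ∉ 𝒞` forces a `y` to exist.
    rcases 𝒞.eq_empty_or_nonempty with rfl | ⟨T, hT⟩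
    · refine ⟨0, fun N hN => ?_⟩
      obtain ⟨D, P, h⟩ := QDisc.exists_strategy_empty hx N hN
      exact ⟨D, P, by simpa using h, by simp⟩
    · obtain ⟨y, hy, hxy⟩ := QDisc.exists_orthogonal_unit hx
        ((hfix T hT _ (QDisc.isPure_vecMulVec hx).isState).2 hket.symm) (fun h => hid (h ▸ hT))
      exact QDisc.exists_strategy_of_orthogonal hx hy hxy h𝒞_closed h𝒞_channel hfix
  refine ⟨hmain, fun t ht hpos hzero hbdd => ?_⟩
  obtain ⟨C, hC⟩ := hmain
  exact QDisc.transmissionFreeDiscriminable_of_bounds ht hpos hzero hbdd hC
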